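/- Let $d\ge 1$, let $\Omega=\{0,1\}^{\mathbb Z^d}$ carry the product $\sigma$-algebra, write $(\theta_x\omega)(y)=\omega(x+y)$ for the shifts, $\mathcal P(\omega)=\{x\in\mathbb Z^d:\omega(x)=1\}$, and $\mathcal E=\{\pm e_1,\dots,\pm e_d\}$ for the set of coordinate directions. Let $Q$ be a probability measure on $\Omega$ that is stationary and ergodic with respect to each of the shifts $\theta_{e_1},\dots,\theta_{e_d}$ and satisfies $Q(\mathcal P(\omega)=\emptyset)<1$. Put $\Omega_0=\{\omega:\omega(0)=1\}$ and $P=Q(\,\cdot\mid\Omega_0)$. For $e\in\mathcal E$ let $$f_e(\omega)=\min\{k\ge 1:\omega(ke)=1\},\qquad \sigma_e(\omega)=\theta_{f_e(\omega)e}\,\omega ,$$ and let $n_k^e(\omega)$ be the distance from $0$ to the $k$-th point of $\mathcal P(\omega)$ in direction $e$, i.e. $n_1^e=f_e$ and $n_{k+1}^e(\omega)=f_e(\omega)+n_k^e(\sigma_e\omega)$; these are well defined and finite for $P$-almost every $\omega$. Assume that $\mathbb E_P[f_e^2]<\infty$ for every $e\in\mathcal E$. Let $N_0(\omega)=\{f_e(\omega)e:e\in\mathcal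 E\}$ and $$(\Lambda f)(\omega)=\frac1{2d}\sum_{x\in N_0(\omega)}f(\theta_x\omega),\qquad V(\omega)=\frac1{2d}\sum_{x\in N_0(\omega)}x .$$ Then for every $\varepsilon>0$ the equation $(1+\varepsilon-\Lambda)\psi_\varepsilon=V$ has a solution $\psi_\varepsilon$ in $L^2(P;\mathbb R^d)$, unique up to $P$-null sets. For every $e\in\mathcal E$ and every integer $j\ge 0$ the corrector $$\chi(je,\cdot)=\lim_{\varepsilon\downarrow0}\mathbb 1_{\{je\in\mathcal P(\omega)\}}\bigl(\psi_\varepsilon\circ\theta_{je}-\psi_\varepsilon\bigr)$$ exists as a limit in $L^2(P;\mathbb R^d)$, and for $P$-almost every $\omega$ $$\lim_{k\to\infty}\frac{\chi(n_k^e(\omega)e,\omega)}{k}=0 .$$ -/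

import Mathlib

open MeasureTheory Filter Topology
open scoped ENNReal

namespace PointProcessWalk

/-- Environments `ω ∈ {0,1}^(ℤ^d)`, with the product σ-algebra (which is the Borel σ-algebra, the
index set being countable). -/
abbrev Env (d : ℕ) : Type := (Fin d → ℤ) → Bool

/-- The shift `θ_x`, `(θ_x ω)(y) = ω (x + y)`. -/
def shift {d : ℕ} (x : Fin d → ℤ) (ω : Env d) : Env d := fun y => ω (x + y)

/-- The `2d` coordinate directions `± e_i`. -/
def directions (d : ℕ) : Finset (Fin d → ℤ) :=
  Finset.univ.image (fun i : Fin d => Pi.single i (1 : ℤ)) ∪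
    Finset.univ.image (fun i : Fin d => Pi.single i (-1 : ℤ))

/-- The standing assumption on the law `Q` of the environment: it is stationary and ergodic under
each of the shifts `θ_{e_i}`, and the point set is not almost surely empty. -/
structure IsErgodicPointProcess {d : ℕ} (Q : Measure (Env d)) : Prop where
  ergodic : ∀ i : Fin d, Ergodic (shift (Pi.single i (1 : ℤ))) Q
  nonempty : Q {ω | {x | ω x = true} = ∅} < 1

/-- `Ω₀`, the environments with a point at the origin. -/
def envZero (d : ℕ) : Set (Env d) := {ω | ω 0 = true}

/-- `P = Q(· | Ω₀)`, regarded as a measure on all environments that is carried by `Ω₀`. -/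
noncomputable def condLaw {d : ℕ} (Q : Measure (Env d)) : Measure (Env d) :=
  ProbabilityTheory.cond Q (envZero d)

/-- `f_e(ω) = min {k > 0 : ω (k e) = 1}`, the distance from the origin to the next point in
direction `e`. (The value is `0` on the null event that there is no such point.) -/
noncomputable def dist {d : ℕ} (e : Fin d → ℤ) (ω : Env d) : ℕ :=
  sInf {k : ℕ | 0 < k ∧ ω (k • e) = true}

/-- The induced shift `σ_e(ω) = θ_e^{f_e(ω)} ω`. -/
noncomputable def inducedShift {d : ℕ} (e : Fin d → ℤ) (ω : Env d) : Env d :=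
  shift (dist e ω • e) ω

/-- `n_k^e(ω)`: the distance from the origin to the `k`-th point of the environment in direction
`e`, that is `n_1 = f_e` and `n_{k+1}(ω) = f_e(ω) + n_k(σ_e ω)`. -/
noncomputable def pointPos {d : ℕ} (e : Fin d → ℤ) : ℕ → Env d → ℕ
  | 0, _ => 0
  | k + 1, ω => dist e ω + pointPos e k (inducedShift e ω)

/-- `N_v(ω)`, the set of the coordinate nearest neighbours of `v`, one in each direction. -/
noncomputable def neighbors {d : ℕ} (v : Fin d → ℤ) (ω : Env d) : Finset (Fin d → ℤ) :=
  (directions d).image (fun e => v + dist e (shift v ω) • e)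

/-- The inclusion `ℤ^d → ℝ^d`. -/
def toSpace {d : ℕ} (x : Fin d → ℤ) : EuclideanSpace ℝ (Fin d) :=
  WithLp.toLp 2 (fun i => (x i : ℝ))

/-- `(Λ f)(ω) = (2d)⁻¹ ∑_{x ∈ N_0(ω)} f(θ_x ω)`. -/
noncomputable def transition {d : ℕ} (f : Env d → EuclideanSpace ℝ (Fin d)) (ω : Env d) :
    EuclideanSpace ℝ (Fin d) :=
  (2 * (d : ℝ))⁻¹ • ∑ x ∈ neighbors 0 ω, f (shift x ω)

/-- The local drift `V(ω) = (2d)⁻¹ ∑_{x ∈ N_0(ω)} x` at the origin. -/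
noncomputable def drift {d : ℕ} (ω : Env d) : EuclideanSpace ℝ (Fin d) :=
  (2 * (d : ℝ))⁻¹ • ∑ x ∈ neighbors 0 ω, toSpace x

/-- `ψ ∈ L²(P; ℝ^d)` and `(1 + ε - Λ) ψ = V` in `L²`. -/
def IsResolventSolution {d : ℕ} (Q : Measure (Env d)) (ε : ℝ)
    (ψ : Env d → EuclideanSpace ℝ (Fin d)) : Prop :=
  MemLp ψ 2 (condLaw Q) ∧
    ∀ᵐ ω ∂(condLaw Q), (1 + ε) • ψ ω - transition ψ ω = drift ω

/-- `ψ_ε`, (a version of) the solution in `L²` of `(1 + ε - Λ) ψ = V`. -/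
noncomputable def psi {d : ℕ} (Q : Measure (Env d)) (ε : ℝ) :
    Env d → EuclideanSpace ℝ (Fin d) :=
  Classical.epsilon (IsResolventSolution Q ε)

/-- `1_{x ∈ 𝒫(ω)} (ψ_ε ∘ θ_x - ψ_ε)`, where `x ∈ 𝒫(ω)` means `ω x = 1`. -/
noncomputable def psiIncrement {d : ℕ} (Q : Measure (Env d)) (ε : ℝ) (x : Fin d → ℤ) :
    Env d → EuclideanSpace ℝ (Fin d) :=
  Set.indicator {ω | ω x = true} (fun ω => psi Q ε (shift x ω) - psi Q ε ω)

/-- `g` is the limit in `L²(P; ℝ^d)` of `1_{x ∈ 𝒫(ω)} (ψ_ε ∘ θ_x - ψ_ε)` as `ε ↓ 0`. -/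
def IsCorrectorAt {d : ℕ} (Q : Measure (Env d)) (x : Fin d → ℤ)
    (g : Env d → EuclideanSpace ℝ (Fin d)) : Prop :=
  MemLp g 2 (condLaw Q) ∧
    Tendsto (fun ε : ℝ => eLpNorm (psiIncrement Q ε x - g) 2 (condLaw Q)) (𝓝[>] 0) (𝓝 0)

/-- The corrector `χ(x, ·)`: (a version of) the limit in `L²` of
`1_{x ∈ 𝒫(ω)} (ψ_ε ∘ θ_x - ψ_ε)` as `ε ↓ 0`. -/
noncomputable def corrector {d : ℕ} (Q : Measure (Env d)) (x : Fin d → ℤ) :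
    Env d → EuclideanSpace ℝ (Fin d) :=
  Classical.epsilon (IsCorrectorAt Q x)

end PointProcessWalk

/-!
Write `U_e ψ = ψ ∘ σ_e` on `L²(P; ℝ^d)`. By stationarity of `Q` each induced shift `σ_e` preserves
`P` (`measurePreserving_inducedShift`), and `σ_{-e}` inverts it, so the `U_e` are unitary with
`U_e⁻¹ = U_{-e}`. Hence `Λ = (2d)⁻¹ ∑_e U_e` is symmetric. With the gradient `D ψ = (U_e ψ - ψ)_e`
and the field of jumps `F = (f_e e)_e`, summation by parts gives `D* D = 4d (1 - Λ)`. Since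
`f_e ∘ σ_{-e} = f_{-e}`, it also gives `D* F = -4d V`. So the resolvent equation is the regularized
normal equation `(4d ε + D* D) ψ_ε = -D* F` (`isAverageResolvent_iff`, `isResolventSolution_iff`).
Lax–Milgram yields existence and uniqueness, and `D ψ_ε` converges to the orthogonal projection of
`-F` onto the closure of the range of `D` (`exists_tendsto_isTikhonovSolution`). Componentwise,
`ψ_ε ∘ σ_e - ψ_ε` converges in `L²` to some `G_e`.

If `j e` is a point of the environment, it is the `k`-th one in direction `e` for some `k ≤ j`, and
`θ_{je} ω = σ_e^k ω`. The increment of `ψ_ε` from `0` to `j e` therefore telescopes along the orbit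
of `σ_e`, and it converges to the Birkhoff sum of order `k` of `G_e` (`isCorrectorAt_orbitSum`).

It remains to see that the ergodic averages of `G_e` tend to zero almost everywhere. This holds for
every `L²` limit of coboundaries `h ∘ σ - h` (`ae_tendsto_birkhoffSum_of_coboundary_limit`): the
Birkhoff sums of a coboundary are `h ∘ σ^k - h`, which is `o(k)` because `h` is square integrable,
and the error of the approximation is controlled by the maximal ergodic inequality.
-/

/-! ### Regularized normal equations in Hilbert spaces -/

section Hilbert

variable {H K : Type*} [NormedAddCommGroup H] [InnerProductSpace ℝ H]
  [NormedAddCommGroup K] [InnerProductSpace ℝ K]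

/-- The weak form of `(ε + T* T) ψ = T* F`. -/
def IsTikhonovSolution (T : H →L[ℝ] K) (F : K) (ε : ℝ) (ψ : H) : Prop :=
  ∀ φ : H, ε * inner ℝ ψ φ + inner ℝ (T ψ) (T φ) = inner ℝ F (T φ)

theorem exists_isTikhonovSolution [CompleteSpace H] [CompleteSpace K] (T : H →L[ℝ] K) (F : K)
    {ε : ℝ} (hε : 0 < ε) :
    ∃ ψ, IsTikhonovSolution T F ε ψ := by
  let B : H →L[ℝ] H →L[ℝ] ℝ :=
    innerSL ℝ ∘L (ε • ContinuousLinearMap.id ℝ H + ContinuousLinearMap.adjoint T ∘L T)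
  have hB : ∀ ψ φ, B ψ φ = ε * inner ℝ ψ φ + inner ℝ (T ψ) (T φ) := fun ψ φ => by
    change inner ℝ (ε • ψ + ContinuousLinearMap.adjoint T (T ψ)) φ = _
    rw [inner_add_left, real_inner_smul_left, ContinuousLinearMap.adjoint_inner_left]
  have hco : IsCoercive B := by
    refine ⟨ε, hε, fun u => ?_⟩
    rw [hB, real_inner_self_eq_norm_mul_norm, real_inner_self_eq_norm_mul_norm]
    nlinarith [mul_self_nonneg ‖T u‖]
  obtain ⟨ψ, hψ⟩ := hco.continuousLinearEquivOfBilin.surjective (ContinuousLinearMap.adjoint T F)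
  refine ⟨ψ, fun φ => ?_⟩
  rw [← hB, ← hco.continuousLinearEquivOfBilin_apply, hψ, ContinuousLinearMap.adjoint_inner_left]

theorem IsTikhonovSolution.unique {T : H →L[ℝ] K} {F : K} {ε : ℝ} (hε : 0 < ε) {ψ ψ' : H}
    (h : IsTikhonovSolution T F ε ψ) (h' : IsTikhonovSolution T F ε ψ') : ψ = ψ' := by
  have h1 := h (ψ - ψ')
  have h2 := h' (ψ - ψ')
  have h3 : ε * inner ℝ (ψ - ψ') (ψ - ψ') + inner ℝ (T (ψ - ψ')) (T (ψ - ψ')) = 0 := by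
    rw [inner_sub_left, map_sub T ψ ψ', inner_sub_left, ← map_sub]
    linarith
  rw [real_inner_self_eq_norm_sq, real_inner_self_eq_norm_sq] at h3
  have h4 : ‖ψ - ψ'‖ ^ 2 = 0 := by
    nlinarith [mul_nonneg hε.le (sq_nonneg ‖ψ - ψ'‖), sq_nonneg ‖T (ψ - ψ')‖]
  exact sub_eq_zero.mp (norm_eq_zero.mp (pow_eq_zero_iff two_ne_zero |>.mp h4))

/-- If `g` differs from `F` by an element orthogonal to the range of `T`, testing the equation
against `ψ - φ` and absorbing the quadratic terms gives this bound. -/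
theorem IsTikhonovSolution.norm_sq_le {T : H →L[ℝ] K} {F g : K} {ε : ℝ} (hε : 0 < ε) {ψ : H}
    (h : IsTikhonovSolution T F ε ψ) (hg : ∀ φ, inner ℝ F (T φ) = inner ℝ g (T φ)) (φ : H) :
    ‖T ψ - T φ‖ ^ 2 ≤ ‖g - T φ‖ ^ 2 + ε * ‖φ‖ ^ 2 := by
  have h1 := h (ψ - φ)
  rw [hg, map_sub] at h1
  have e1 : inner ℝ ψ (ψ - φ) = ‖ψ - φ‖ ^ 2 + inner ℝ φ (ψ - φ) := by
    rw [← real_inner_self_eq_norm_sq, inner_sub_left]; ring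
  have e2 : inner ℝ (T ψ) (T ψ - T φ) = ‖T ψ - T φ‖ ^ 2 + inner ℝ (T φ) (T ψ - T φ) := by
    rw [← real_inner_self_eq_norm_sq, inner_sub_left]; ring
  have e3 : inner ℝ g (T ψ - T φ) = inner ℝ (g - T φ) (T ψ - T φ)
      + inner ℝ (T φ) (T ψ - T φ) := by
    rw [inner_sub_left]; ring
  have b1 := real_inner_le_norm (g - T φ) (T ψ - T φ)
  have b2 := abs_le.mp (abs_real_inner_le_norm φ (ψ - φ))
  rw [e1, e2, e3] at h1
  have b3 : ε * -(‖φ‖ * ‖ψ - φ‖) ≤ ε * inner ℝ φ (ψ - φ) := mul_le_mul_of_nonneg_left b2.1 hε.le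
  nlinarith [sq_nonneg (‖g - T φ‖ - ‖T ψ - T φ‖), mul_nonneg hε.le (sq_nonneg (‖φ‖ - 2 * ‖ψ - φ‖)),
    mul_nonneg hε.le (sq_nonneg ‖φ‖)]

/-- Along solutions of the regularized equations, `T ψ_ε` converges to the orthogonal projection
of `F` onto the closure of the range of `T`. -/
theorem exists_tendsto_isTikhonovSolution [CompleteSpace K] (T : H →L[ℝ] K) (F : K) :
    ∃ g : K, ∀ ψ : ℝ → H, (∀ ε, 0 < ε → IsTikhonovSolution T F ε (ψ ε)) →
      Tendsto (fun ε => T (ψ ε)) (𝓝[>] 0) (𝓝 g) := by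
  let S : Submodule ℝ K := T.range.topologicalClosure
  have : CompleteSpace S := T.range.isClosed_topologicalClosure.completeSpace_coe
  refine ⟨S.starProjection F, fun ψ hψ => ?_⟩
  have horth : ∀ φ, inner ℝ F (T φ) = inner ℝ (S.starProjection F) (T φ) := fun φ => by
    have h := S.starProjection_inner_eq_zero F (T φ)
      (T.range.le_topologicalClosure ⟨φ, rfl⟩)
    rw [inner_sub_left] at h
    linarith
  rw [Metric.tendsto_nhds]
  intro δ hδ
  obtain ⟨_, ⟨φ, rfl⟩, hφ⟩ := Metric.mem_closure_iff.mp
    (show S.starProjection F ∈ closure (T.range : Set K) from S.starProjection_apply_mem F)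
    (δ / 4) (by positivity)
  rw [dist_eq_norm] at hφ
  have hsmall : ∀ᶠ ε : ℝ in 𝓝[>] 0, ε * ‖φ‖ ^ 2 < (δ / 4) ^ 2 := by
    have : Tendsto (fun ε : ℝ => ε * ‖φ‖ ^ 2) (𝓝[>] 0) (𝓝 (0 * ‖φ‖ ^ 2)) :=
      (tendsto_id.mono_left nhdsWithin_le_nhds).mul_const _
    rw [zero_mul] at this
    exact this.eventually_lt_const (by positivity)
  filter_upwards [hsmall, self_mem_nhdsWithin] with ε hε hpos
  have h1 := (hψ ε hpos).norm_sq_le hpos horth φ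
  have hφ' : ‖S.starProjection F - T φ‖ < δ / 4 := hφ
  have h2 : ‖T (ψ ε) - T φ‖ < δ / 2 := by
    refine lt_of_pow_lt_pow_left₀ 2 (by positivity) ?_
    nlinarith [norm_nonneg (S.starProjection F - T φ)]
  rw [dist_eq_norm]
  calc ‖T (ψ ε) - S.starProjection F‖
      = ‖(T (ψ ε) - T φ) - (S.starProjection F - T φ)‖ := by congr 1; abel
    _ ≤ ‖T (ψ ε) - T φ‖ + ‖S.starProjection F - T φ‖ := norm_sub_le _ _
    _ < δ := by linarith

end Hilbert

/-! ### Resolvent equations for symmetric averages of isometries -/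

section Isometries

variable {H ι : Type*} [NormedAddCommGroup H] [InnerProductSpace ℝ H]

/-- The resolvent equation `(1 + ε - Λ) ψ = c ∑ F_e` for the average `Λ = c ∑ U_e`. -/
def IsAverageResolvent [Fintype ι] (U : ι → H →ₗᵢ[ℝ] H) (F : ι → H) (c ε : ℝ) (ψ : H) : Prop :=
  (1 + ε) • ψ - c • ∑ e, U e ψ = c • ∑ e, F e

/-- The gradient `ψ ↦ (U_e ψ - ψ)_e`. -/
noncomputable def isometryGradient [Fintype ι] (U : ι → H →ₗᵢ[ℝ] H) :
    H →L[ℝ] PiLp 2 (fun _ : ι => H) :=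
  (PiLp.continuousLinearEquiv 2 ℝ (fun _ : ι => H)).symm.toContinuousLinearMap ∘L
    ContinuousLinearMap.pi (fun e => (U e).toContinuousLinearMap - ContinuousLinearMap.id ℝ H)

theorem isometryGradient_apply [Fintype ι] (U : ι → H →ₗᵢ[ℝ] H) (ψ : H) (e : ι) :
    isometryGradient U ψ e = U e ψ - ψ := rfl

theorem inner_isometry_left {U U' : H →ₗᵢ[ℝ] H} (h : ∀ φ, U (U' φ) = φ) (x y : H) :
    inner ℝ x (U y) = inner ℝ (U' x) y := by
  rw [← U.inner_map_map (U' x) y, h]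

/-- Summation by parts: the resolvent equation is the normal equation of the gradient. The two
sides of the former are half of those of the latter times `c`, since `U_e ψ` and `F_e` both arise
twice, from the directions `e` and `-e`. This turns `ε` into `2 ε / c`. -/
theorem isAverageResolvent_iff [Fintype ι] {U : ι → H →ₗᵢ[ℝ] H} {F : ι → H} (neg : Equiv.Perm ι)
    (hU : ∀ e φ, U e (U (neg e) φ) = φ) (hF : ∀ e, U (neg e) (F e) = -F (neg e))
    {c : ℝ} (hc : c * Fintype.card ι = 1) (ε : ℝ) (ψ : H) :
    IsAverageResolvent U F c ε ψ ↔
      IsTikhonovSolution (isometryGradient U) (WithLp.toLp 2 fun e => -F e) (2 * ε / c) ψ := by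
  have hc0 : c ≠ 0 := by rintro rfl; simp at hc
  have key : ∀ φ, (2 * ε / c) * inner ℝ ψ φ + inner ℝ (isometryGradient U ψ) (isometryGradient U φ)
      - inner ℝ (WithLp.toLp 2 fun e => -F e) (isometryGradient U φ)
      = (2 / c) * inner ℝ ((1 + ε) • ψ - c • ∑ e, U e ψ - c • ∑ e, F e) φ := by
    intro φ
    have h1 : inner ℝ (isometryGradient U ψ) (isometryGradient U φ)
        = 2 * Fintype.card ι * inner ℝ ψ φ - 2 * inner ℝ (∑ e, U e ψ) φ := by
      have : ∀ e, inner ℝ (U e ψ - ψ) (U e φ - φ)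
          = 2 * inner ℝ ψ φ - inner ℝ (U e ψ) φ - inner ℝ (U (neg e) ψ) φ := fun e => by
        rw [inner_sub_left, inner_sub_right, inner_sub_right, LinearIsometry.inner_map_map,
          inner_isometry_left (hU e)]
        ring
      rw [PiLp.inner_apply]
      simp only [isometryGradient_apply, this, Finset.sum_sub_distrib, ← sum_inner]
      rw [Equiv.sum_comp neg (fun e => U e ψ)]
      simp
      ring
    have h2 : inner ℝ (WithLp.toLp 2 fun e => -F e) (isometryGradient U φ)
        = 2 * inner ℝ (∑ e, F e) φ := by
      have : ∀ e, inner ℝ (-F e) (U e φ - φ) = inner ℝ (F (neg e)) φ + inner ℝ (F e) φ := fun e => by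
        rw [inner_sub_right, inner_isometry_left (hU e), map_neg, hF, neg_neg, inner_neg_left]
        ring
      rw [PiLp.inner_apply]
      simp only [isometryGradient_apply, this, Finset.sum_add_distrib, ← sum_inner]
      rw [Equiv.sum_comp neg F]
      ring
    rw [h1, h2, inner_sub_left, inner_sub_left, inner_smul_left, inner_smul_left, inner_smul_left]
    simp only [conj_trivial]
    field_simp
    linear_combination inner ℝ ψ φ * hc
  constructor
  · intro h φ
    have := key φ
    rw [show (1 + ε) • ψ - c • ∑ e, U e ψ - c • ∑ e, F e = 0 from sub_eq_zero.mpr h,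
      inner_zero_left, mul_zero] at this
    linarith
  · intro h
    refine sub_eq_zero.mp ?_
    have := key ((1 + ε) • ψ - c • ∑ e, U e ψ - c • ∑ e, F e)
    rw [h, sub_self, eq_comm, mul_eq_zero] at this
    exact inner_self_eq_zero.mp (this.resolve_left (by positivity))

theorem existsUnique_isAverageResolvent [Fintype ι] [CompleteSpace H]
    {U : ι → H →ₗᵢ[ℝ] H} {F : ι → H} (neg : Equiv.Perm ι)
    (hU : ∀ e φ, U e (U (neg e) φ) = φ) (hF : ∀ e, U (neg e) (F e) = -F (neg e))
    {c : ℝ} (hc : c * Fintype.card ι = 1) {ε : ℝ} (hε : 0 < ε) :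
    ∃! ψ, IsAverageResolvent U F c ε ψ := by
  have hc0 : 0 < c := pos_of_mul_pos_left (hc.symm ▸ one_pos) (Nat.cast_nonneg _)
  have hpos : 0 < 2 * ε / c := by positivity
  simp only [isAverageResolvent_iff neg hU hF hc]
  obtain ⟨ψ, hψ⟩ := exists_isTikhonovSolution (isometryGradient U)
    (WithLp.toLp 2 fun e => -F e) hpos
  exact ⟨ψ, hψ, fun φ hφ => IsTikhonovSolution.unique hpos hφ hψ⟩

/-- The gradients of the resolvent solutions converge as `ε ↓ 0`. -/
theorem exists_tendsto_isAverageResolvent [Fintype ι] [CompleteSpace H]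
    {U : ι → H →ₗᵢ[ℝ] H} {F : ι → H} (neg : Equiv.Perm ι)
    (hU : ∀ e φ, U e (U (neg e) φ) = φ) (hF : ∀ e, U (neg e) (F e) = -F (neg e))
    {c : ℝ} (hc : c * Fintype.card ι = 1) :
    ∃ G : ι → H, ∀ ψ : ℝ → H, (∀ ε, 0 < ε → IsAverageResolvent U F c ε (ψ ε)) →
      ∀ e, Tendsto (fun ε => U e (ψ ε) - ψ ε) (𝓝[>] 0) (𝓝 (G e)) := by
  have hc0 : 0 < c := pos_of_mul_pos_left (hc.symm ▸ one_pos) (Nat.cast_nonneg _)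
  obtain ⟨g, hg⟩ := exists_tendsto_isTikhonovSolution (isometryGradient U)
    (WithLp.toLp 2 fun e => -F e)
  refine ⟨fun e => g e, fun ψ hψ e => ?_⟩
  have h1 := hg (fun ε => ψ (c / 2 * ε)) fun ε hε => by
    have := (isAverageResolvent_iff neg hU hF hc _ _).mp (hψ (c / 2 * ε) (by positivity))
    rwa [show 2 * (c / 2 * ε) / c = ε by field_simp] at this
  -- undo the change of the regularization parameter
  have h2 : Tendsto (fun ε : ℝ => 2 / c * ε) (𝓝[>] 0) (𝓝[>] 0) := by
    refine tendsto_nhdsWithin_iff.mpr ⟨?_, ?_⟩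
    · have : Tendsto (fun ε : ℝ => 2 / c * ε) (𝓝[>] 0) (𝓝 (2 / c * 0)) :=
        (tendsto_id.mono_left nhdsWithin_le_nhds).const_mul _
      simpa using this
    · filter_upwards [self_mem_nhdsWithin] with ε hε
      exact mul_pos (div_pos two_pos hc0) hε
  have h3 := Tendsto.comp ((PiLp.continuous_apply 2 (fun _ : ι => H) e).tendsto g) (h1.comp h2)
  refine h3.congr fun ε => ?_
  simp only [Function.comp_apply, isometryGradient_apply]
  rw [show c / 2 * (2 / c * ε) = ε by field_simp]

end Isometries

/-! ### Ergodic averages of limits of coboundaries -/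

section Ergodic

variable {α : Type*} {σ : α → α}

/-- The maximum of the Birkhoff sums of `g` of orders `0, …, n`, by recursion on `n`. -/
def maxBirkhoffSum (σ : α → α) (g : α → ℝ) : ℕ → α → ℝ
  | 0, _ => 0
  | n + 1, x => max 0 (g x + maxBirkhoffSum σ g n (σ x))

theorem maxBirkhoffSum_nonneg (g : α → ℝ) (n : ℕ) (x : α) : 0 ≤ maxBirkhoffSum σ g n x := by
  cases n with
  | zero => exact le_rfl
  | succ n => exact le_max_left _ _

theorem maxBirkhoffSum_le_succ (g : α → ℝ) (n : ℕ) (x : α) :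
    maxBirkhoffSum σ g n x ≤ maxBirkhoffSum σ g (n + 1) x := by
  induction n generalizing x with
  | zero => exact maxBirkhoffSum_nonneg g 1 x
  | succ n ih => exact max_le_max le_rfl (add_le_add le_rfl (ih _))

theorem birkhoffSum_le_maxBirkhoffSum (g : α → ℝ) {k n : ℕ} (hk : k ≤ n) (x : α) :
    birkhoffSum σ g k x ≤ maxBirkhoffSum σ g n x := by
  induction n generalizing x k with
  | zero => obtain rfl := Nat.le_zero.mp hk; simp [maxBirkhoffSum]
  | succ n ih =>
    cases k with
    | zero => simpa using maxBirkhoffSum_nonneg g (n + 1) x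
    | succ k =>
      rw [birkhoffSum_succ']
      exact (add_le_add le_rfl (ih (Nat.le_of_succ_le_succ hk) _)).trans (le_max_right _ _)

theorem birkhoffSum_coboundary {E : Type*} [AddCommGroup E] (h : α → E) (k : ℕ) (x : α) :
    birkhoffSum σ (fun x => h (σ x) - h x) k x = h (σ^[k] x) - h x := by
  simp only [birkhoffSum, ← Function.iterate_succ_apply']
  exact Finset.sum_range_sub (fun i => h (σ^[i] x)) k

variable [MeasurableSpace α] {μ : Measure α}

theorem integrable_maxBirkhoffSum (hσ : MeasurePreserving σ μ μ) {g : α → ℝ}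
    (hg : Integrable g μ) (n : ℕ) : Integrable (maxBirkhoffSum σ g n) μ := by
  induction n with
  | zero => exact integrable_zero _ _ _
  | succ n ih => exact (integrable_zero _ _ _).sup (hg.add (hσ.integrable_comp_of_integrable ih))

/-- The maximal ergodic inequality, by Garsia's argument: where the maximum `M` is positive,
`g ≥ M - M ∘ σ`, and elsewhere `M - M ∘ σ ≤ 0`. -/
theorem setIntegral_maxBirkhoffSum_pos_nonneg (hσ : MeasurePreserving σ μ μ) {g : α → ℝ}
    (hg : Integrable g μ) (n : ℕ) :
    0 ≤ ∫ x in {x | 0 < maxBirkhoffSum σ g n x}, g x ∂μ := by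
  cases n with
  | zero => simp [maxBirkhoffSum]
  | succ n =>
  set M := maxBirkhoffSum σ g (n + 1)
  have hMi : Integrable M μ := integrable_maxBirkhoffSum hσ hg _
  have hMσ : Integrable (fun x => M (σ x)) μ := hσ.integrable_comp_of_integrable hMi
  have hs : NullMeasurableSet {x | 0 < M x} μ :=
    nullMeasurableSet_lt aemeasurable_const hMi.aemeasurable
  have h0 : ∫ x, (M x - M (σ x)) ∂μ = 0 := by
    rw [integral_sub hMi hMσ, sub_eq_zero]
    have := integral_map (μ := μ) hσ.aemeasurable (f := M) (hσ.map_eq.symm ▸ hMi.1)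
    rwa [hσ.map_eq] at this
  rw [← integral_indicator₀ hs]
  refine h0.symm.le.trans ?_
  refine integral_mono (hMi.sub hMσ) (hg.indicator₀ hs) fun x => ?_
  have hle := maxBirkhoffSum_le_succ (σ := σ) g n (σ x)
  by_cases hx : 0 < M x
  · rw [Set.indicator_of_mem (show x ∈ {x | 0 < M x} from hx)]
    -- `M x` is positive, so the maximum in its recursion is not attained at `0`
    have : M x = g x + maxBirkhoffSum σ g n (σ x) := by
      rcases max_choice 0 (g x + maxBirkhoffSum σ g n (σ x)) with h | h
      · exact absurd (h : M x = 0) hx.ne'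
      · exact h
    linarith
  · rw [Set.indicator_of_notMem (show x ∉ {x | 0 < M x} from hx)]
    have := maxBirkhoffSum_nonneg (σ := σ) g (n + 1) (σ x)
    linarith [not_lt.mp hx]

/-- Weak-type bound for the maximal function of the ergodic averages. -/
theorem measure_exists_birkhoffSum_gt_le [IsFiniteMeasure μ] (hσ : MeasurePreserving σ μ μ)
    {g : α → ℝ} (hg : Integrable g μ) (h0 : ∀ x, 0 ≤ g x) {r : ℝ} (hr : 0 < r) :
    μ {x | ∃ k, k * r < birkhoffSum σ g k x} ≤ ENNReal.ofReal ((∫ x, g x ∂μ) / r) := by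
  have hgi : Integrable (fun x => g x - r) μ := hg.sub (integrable_const r)
  let A : ℕ → Set α := fun n => {x | 0 < maxBirkhoffSum σ (fun x => g x - r) n x}
  have hmono : Monotone A := monotone_nat_of_le_succ fun n x hx =>
    lt_of_lt_of_le hx (maxBirkhoffSum_le_succ _ n x)
  have hsub : {x | ∃ k : ℕ, k * r < birkhoffSum σ g k x} ⊆ ⋃ n, A n := by
    rintro x ⟨k, hk⟩
    refine Set.mem_iUnion.mpr ⟨k, lt_of_lt_of_le ?_ (birkhoffSum_le_maxBirkhoffSum _ le_rfl x)⟩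
    have : birkhoffSum σ (fun x => g x - r) k x = birkhoffSum σ g k x - k * r := by
      simp [birkhoffSum]
    linarith
  refine (measure_mono hsub).trans ?_
  rw [hmono.measure_iUnion]
  refine iSup_le fun n => ?_
  have h1 := setIntegral_maxBirkhoffSum_pos_nonneg hσ hgi n
  change 0 ≤ ∫ x in A n, (g x - r) ∂μ at h1
  rw [integral_sub hg.integrableOn (integrable_const r), setIntegral_const, smul_eq_mul,
    sub_nonneg] at h1
  have h2 : ∫ x in A n, g x ∂μ ≤ ∫ x, g x ∂μ :=
    setIntegral_le_integral hg (ae_of_all _ h0)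
  rw [← ofReal_measureReal (measure_ne_top μ (A n))]
  exact ENNReal.ofReal_le_ofReal ((le_div_iff₀ hr).mpr (h1.trans h2))

variable {E : Type*} [NormedAddCommGroup E]

/-- Square integrable functions grow sublinearly along almost every orbit, because
`∑ k⁻² ‖h ∘ σ^k‖²` is integrable. -/
theorem ae_tendsto_norm_iterate_div (hσ : MeasurePreserving σ μ μ) {h : α → E}
    (hh : MemLp h 2 μ) : ∀ᵐ x ∂μ, Tendsto (fun k : ℕ => ‖h (σ^[k] x)‖ / k) atTop (𝓝 0) := by
  have hm : ∀ k : ℕ, AEMeasurable (fun x => ‖h (σ^[k] x)‖ₑ ^ 2) μ := fun k =>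
    (hh.1.comp_measurePreserving (hσ.iterate k)).enorm.pow_const 2
  have hint : ∀ k : ℕ, ∫⁻ x, ‖h (σ^[k] x)‖ₑ ^ 2 ∂μ = ∫⁻ x, ‖h x‖ₑ ^ 2 ∂μ := fun k => by
    have := lintegral_map' (μ := μ) (f := fun x => ‖h x‖ₑ ^ 2) (g := σ^[k])
      (by rw [(hσ.iterate k).map_eq]; exact hm 0) (hσ.iterate k).aemeasurable
    rw [(hσ.iterate k).map_eq] at this
    exact this.symm
  have hfin : ∫⁻ x, ‖h x‖ₑ ^ 2 ∂μ ≠ ∞ := by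
    have := lintegral_rpow_enorm_lt_top_of_eLpNorm_lt_top two_ne_zero ENNReal.ofNat_ne_top hh.2
    simpa using this.ne
  -- the term `k = 0` is harmless, as `1 / 0 = 0`
  let c : ℕ → ℝ≥0∞ := fun k => ENNReal.ofReal (1 / ((k : ℝ) ^ 2))
  have hc : ∑' k, c k ≠ ∞ :=
    (Real.summable_one_div_nat_pow.mpr one_lt_two).tsum_ofReal_ne_top
  have htot : ∫⁻ x, ∑' k, c k * ‖h (σ^[k] x)‖ₑ ^ 2 ∂μ ≠ ∞ := by
    rw [lintegral_tsum fun k => (hm k).const_mul _]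
    simp_rw [lintegral_const_mul'' _ (hm _), hint]
    rw [ENNReal.tsum_mul_right]
    exact ENNReal.mul_ne_top hc hfin
  filter_upwards [ae_lt_top' (AEMeasurable.tsum fun k => (hm k).const_mul _) htot]
    with x hx
  have h1 := ENNReal.tendsto_atTop_zero_of_tsum_ne_top hx.ne
  have h2 : Tendsto (fun k : ℕ => (‖h (σ^[k] x)‖ / k) ^ 2) atTop (𝓝 0) := by
    refine ((ENNReal.tendsto_toReal ENNReal.zero_ne_top).comp h1).congr fun k => ?_
    simp only [Function.comp_apply, c, ENNReal.toReal_mul, ENNReal.toReal_pow, toReal_enorm]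
    rw [ENNReal.toReal_ofReal (by positivity)]
    ring
  have h3 := h2.sqrt
  simpa [Real.sqrt_sq (div_nonneg (norm_nonneg _) (Nat.cast_nonneg _))] using h3

/-- If `G` is close to a coboundary `h ∘ σ - h`, the maximal inequality bounds the set where the
ergodic averages of `G` are not eventually small. -/
theorem measure_not_eventually_birkhoffSum_le [IsFiniteMeasure μ] (hσ : MeasurePreserving σ μ μ)
    {G h : α → E} (hG : MemLp G 2 μ) (hh : MemLp h 2 μ) {r : ℝ} (hr : 0 < r) :
    μ {x | ¬ ∀ᶠ k : ℕ in atTop, ‖birkhoffSum σ G k x‖ ≤ k * (2 * r)} ≤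
      ENNReal.ofReal ((∫ x, ‖G x - (h (σ x) - h x)‖ ∂μ) / r) := by
  have hd : Integrable (fun x => G x - (h (σ x) - h x)) μ :=
    (hG.sub ((hh.comp_measurePreserving hσ).sub hh)).integrable one_le_two
  refine (measure_mono_ae ?_).trans (measure_exists_birkhoffSum_gt_le hσ hd.norm
    (fun x => norm_nonneg _) hr)
  filter_upwards [ae_tendsto_norm_iterate_div hσ hh] with x hx hnot
  by_contra hle
  apply hnot
  change ¬ ∃ k : ℕ, k * r < birkhoffSum σ (fun x => ‖G x - (h (σ x) - h x)‖) k x at hle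
  push Not at hle
  have hlim : Tendsto (fun k : ℕ => ‖h (σ^[k] x)‖ / k + ‖h x‖ / k) atTop (𝓝 (0 + 0)) :=
    hx.add (tendsto_const_div_atTop_nhds_zero_nat _)
  rw [add_zero] at hlim
  filter_upwards [hlim.eventually_lt_const hr, eventually_gt_atTop 0] with k hk hk0
  have hk0' : (0 : ℝ) < k := Nat.cast_pos.mpr hk0
  rw [← add_div, div_lt_iff₀ hk0'] at hk
  have h1 : birkhoffSum σ G k x =
      birkhoffSum σ (fun x => G x - (h (σ x) - h x)) k x + (h (σ^[k] x) - h x) := by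
    rw [← birkhoffSum_coboundary, ← birkhoffSum_add']
    congr 1
    funext y
    simp
  rw [h1]
  calc _ ≤ ‖birkhoffSum σ (fun x => G x - (h (σ x) - h x)) k x‖ + ‖h (σ^[k] x) - h x‖ :=
        norm_add_le _ _
    _ ≤ birkhoffSum σ (fun x => ‖G x - (h (σ x) - h x)‖) k x + (‖h (σ^[k] x)‖ + ‖h x‖) :=
        add_le_add (norm_sum_le _ _) (norm_sub_le _ _)
    _ ≤ k * (2 * r) := by linarith [hle k]

/-- The ergodic averages of an `L²` limit of coboundaries tend to zero almost everywhere. -/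
theorem ae_tendsto_birkhoffSum_of_coboundary_limit [IsFiniteMeasure μ] [NormedSpace ℝ E]
    (hσ : MeasurePreserving σ μ μ) {ι : Type*} {l : Filter ι} [l.NeBot] {G : α → E}
    {h : ι → α → E} (hG : MemLp G 2 μ) (hh : ∀ i, MemLp (h i) 2 μ)
    (hlim : Tendsto (fun i => eLpNorm (fun x => h i (σ x) - h i x - G x) 2 μ) l (𝓝 0)) :
    ∀ᵐ x ∂μ, Tendsto (fun k : ℕ => (k : ℝ)⁻¹ • birkhoffSum σ G k x) atTop (𝓝 0) := by
  have hint : ∀ i, Integrable (fun x => G x - (h i (σ x) - h i x)) μ := fun i =>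
    (hG.sub (((hh i).comp_measurePreserving hσ).sub (hh i))).integrable one_le_two
  have hL1 : Tendsto (fun i => ENNReal.ofReal (∫ x, ‖G x - (h i (σ x) - h i x)‖ ∂μ)) l (𝓝 0) := by
    have hC : Tendsto (fun i => eLpNorm (fun x => h i (σ x) - h i x - G x) 2 μ *
        μ Set.univ ^ (1 / (1 : ℝ≥0∞).toReal - 1 / (2 : ℝ≥0∞).toReal)) l (𝓝 0) := by
      have := ENNReal.Tendsto.mul_const hlim (Or.inr (ENNReal.rpow_ne_top_of_nonneg
        (y := 1 / (1 : ℝ≥0∞).toReal - 1 / (2 : ℝ≥0∞).toReal) (by norm_num)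
        (measure_ne_top μ Set.univ)))
      rwa [zero_mul] at this
    refine tendsto_of_tendsto_of_tendsto_of_le_of_le tendsto_const_nhds hC (fun i => zero_le)
      fun i => ?_
    rw [ofReal_integral_norm_eq_lintegral_enorm (hint i), ← eLpNorm_one_eq_lintegral_enorm]
    refine (eLpNorm_le_eLpNorm_mul_rpow_measure_univ one_le_two (hint i).1).trans (le_of_eq ?_)
    congr 1
    rw [← eLpNorm_neg]
    congr 1
    funext x
    simp
  have hae : ∀ n : ℕ, ∀ᵐ x ∂μ, ∀ᶠ k : ℕ in atTop,
      ‖birkhoffSum σ G k x‖ ≤ k * (2 * (1 / ((n : ℝ) + 1))) := fun n => by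
    have hr : (0 : ℝ) < 1 / ((n : ℝ) + 1) := by positivity
    refine le_antisymm (ge_of_tendsto' (x := l) (f := fun i => ENNReal.ofReal
      ((∫ x, ‖G x - (h i (σ x) - h i x)‖ ∂μ) / (1 / ((n : ℝ) + 1)))) ?_
      fun i => measure_not_eventually_birkhoffSum_le hσ hG (hh i) hr) zero_le
    have := ENNReal.Tendsto.mul_const (b := ENNReal.ofReal ((n : ℝ) + 1)) hL1
      (Or.inr ENNReal.ofReal_ne_top)
    rw [zero_mul] at this
    refine this.congr fun i => ?_
    rw [← ENNReal.ofReal_mul (integral_nonneg fun x => norm_nonneg _), div_div_eq_mul_div, div_one]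
  filter_upwards [ae_all_iff.mpr hae] with x hx
  rw [Metric.tendsto_nhds]
  intro δ hδ
  obtain ⟨n, hn⟩ := exists_nat_one_div_lt (show 0 < δ / 2 by positivity)
  filter_upwards [hx n, eventually_gt_atTop 0] with k hk hk0
  have hk0' : (0 : ℝ) < k := Nat.cast_pos.mpr hk0
  rw [dist_zero_right, norm_smul, norm_inv, Real.norm_of_nonneg hk0'.le, inv_mul_lt_iff₀ hk0']
  exact hk.trans_lt (mul_lt_mul_of_pos_left (by linarith) hk0')

end Ergodic

/-! ### Shifts and the induced shift -/

namespace PointProcessWalk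

variable {d : ℕ}

theorem shift_shift (x y : Fin d → ℤ) (ω : Env d) : shift x (shift y ω) = shift (y + x) ω := by
  funext z
  simp [shift, add_assoc]

theorem shift_zero (ω : Env d) : shift 0 ω = ω := by
  funext z
  simp [shift]

theorem measurable_shift (x : Fin d → ℤ) : Measurable (shift x : Env d → Env d) :=
  measurable_pi_lambda _ fun y => measurable_pi_apply (x + y)

/-- The shift `θ_x` as a measurable automorphism of the space of environments. -/
def shiftEquiv (x : Fin d → ℤ) : Env d ≃ᵐ Env d where
  toFun := shift x
  invFun := shift (-x)
  left_inv ω := by rw [shift_shift, add_neg_cancel, shift_zero]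
  right_inv ω := by rw [shift_shift, neg_add_cancel, shift_zero]
  measurable_toFun := measurable_shift x
  measurable_invFun := measurable_shift (-x)

theorem shift_iterate (e : Fin d → ℤ) (n : ℕ) (ω : Env d) : (shift e)^[n] ω = shift (n • e) ω := by
  induction n with
  | zero => simp [shift_zero]
  | succ n ih => rw [Function.iterate_succ_apply', ih, shift_shift, succ_nsmul]

theorem mem_directions {e : Fin d → ℤ} :
    e ∈ directions d ↔ ∃ i, e = Pi.single i 1 ∨ e = -Pi.single i 1 := by
  simp only [directions, Finset.mem_union, Finset.mem_image, Finset.mem_univ, true_and,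
    Pi.single_neg, ← exists_or, eq_comm (a := e)]

theorem neg_mem_directions {e : Fin d → ℤ} (he : e ∈ directions d) : -e ∈ directions d := by
  obtain ⟨i, rfl | rfl⟩ := mem_directions.mp he
  · exact mem_directions.mpr ⟨i, Or.inr rfl⟩
  · exact mem_directions.mpr ⟨i, Or.inl (neg_neg _)⟩

theorem single_index_injective {a : ℤ} (ha : a ≠ 0) :
    Function.Injective fun i : Fin d => (Pi.single i a : Fin d → ℤ) := fun i j h => by
  by_contra hij
  have := congrFun h i
  simp [hij, ha] at this

theorem card_directions : (directions d).card = 2 * d := by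
  rw [directions, Finset.card_union_of_disjoint, Finset.card_image_of_injective,
    Finset.card_image_of_injective, Finset.card_univ, Fintype.card_fin, two_mul]
  · exact single_index_injective (by norm_num)
  · exact single_index_injective (by norm_num)
  · rw [Finset.disjoint_left]
    simp only [Finset.mem_image, Finset.mem_univ, true_and, not_exists]
    rintro _ ⟨i, rfl⟩ j hij
    have := congrFun hij j
    rw [Pi.single_eq_same, Pi.single_apply] at this
    split_ifs at this

theorem IsErgodicPointProcess.measurePreserving_shift {Q : Measure (Env d)}
    (hQ : IsErgodicPointProcess Q) {e : Fin d → ℤ} (he : e ∈ directions d) :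
    MeasurePreserving (shift e) Q Q := by
  obtain ⟨i, rfl | rfl⟩ := mem_directions.mp he
  · exact (hQ.ergodic i).toMeasurePreserving
  · exact MeasurePreserving.symm (shiftEquiv (Pi.single i 1)) (hQ.ergodic i).toMeasurePreserving

theorem measurePreserving_shift_nsmul {Q : Measure (Env d)} {e : Fin d → ℤ}
    (he : MeasurePreserving (shift e) Q Q) (n : ℕ) : MeasurePreserving (shift (n • e)) Q Q := by
  have := he.iterate n
  rwa [show (shift e)^[n] = shift (n • e) from funext (shift_iterate e n)] at this

theorem dist_eq_iff {e : Fin d → ℤ} {ω : Env d} {n : ℕ} (hn : 0 < n) :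
    dist e ω = n ↔ ω (n • e) = true ∧ ∀ m, 0 < m → m < n → ω (m • e) ≠ true := by
  constructor
  · intro h
    have hne : {k : ℕ | 0 < k ∧ ω (k • e) = true}.Nonempty :=
      Nat.nonempty_of_pos_sInf (hn.trans_eq h.symm)
    refine ⟨h ▸ (Nat.sInf_mem hne).2, fun m hm hmn hω => ?_⟩
    exact absurd (Nat.sInf_le (show m ∈ {k : ℕ | 0 < k ∧ ω (k • e) = true} from ⟨hm, hω⟩))
      (not_le.mpr (hmn.trans_eq h.symm))
  · rintro ⟨h1, h2⟩
    refine le_antisymm (Nat.sInf_le ⟨hn, h1⟩) (le_csInf ⟨n, hn, h1⟩ fun m hm => ?_)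
    by_contra hlt
    exact h2 m hm.1 (not_le.mp hlt) hm.2

theorem dist_pos_iff {e : Fin d → ℤ} {ω : Env d} :
    0 < dist e ω ↔ ∃ n, 0 < n ∧ ω (n • e) = true := by
  constructor
  · intro h
    exact Nat.nonempty_of_pos_sInf h
  · intro h
    exact (Nat.sInf_mem (s := {k : ℕ | 0 < k ∧ ω (k • e) = true}) h).1

theorem dist_le {e : Fin d → ℤ} {ω : Env d} {n : ℕ} (hn : 0 < n) (h : ω (n • e) = true) :
    dist e ω ≤ n :=
  Nat.sInf_le ⟨hn, h⟩

theorem apply_dist {e : Fin d → ℤ} {ω : Env d} (h : 0 < dist e ω) : ω (dist e ω • e) = true :=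
  ((dist_eq_iff h).mp rfl).1

theorem inducedShift_mem_envZero {e : Fin d → ℤ} {ω : Env d} (h : 0 < dist e ω) :
    inducedShift e ω ∈ envZero d := by
  simpa [envZero, inducedShift, shift] using apply_dist h

/-- Looking back from the next point in direction `e` one sees the origin. -/
theorem dist_neg_inducedShift {e : Fin d → ℤ} {ω : Env d} (h0 : ω ∈ envZero d)
    (h : 0 < dist e ω) : dist (-e) (inducedShift e ω) = dist e ω := by
  rw [dist_eq_iff h]
  refine ⟨by simpa [inducedShift, shift, envZero] using h0, fun m hm hmn => ?_⟩
  have := ((dist_eq_iff h).mp rfl).2 (dist e ω - m) (by omega) (by omega)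
  have e1 : dist e ω • e + m • -e = (dist e ω - m) • e := by
    rw [smul_neg, ← sub_eq_add_neg, sub_nsmul _ hmn.le, sub_eq_add_neg]
  rwa [inducedShift, shift, e1]

theorem inducedShift_neg_inducedShift {e : Fin d → ℤ} {ω : Env d} (h0 : ω ∈ envZero d)
    (h : 0 < dist e ω) : inducedShift (-e) (inducedShift e ω) = ω := by
  rw [inducedShift, dist_neg_inducedShift h0 h, inducedShift, shift_shift, smul_neg,
    add_neg_cancel, shift_zero]

theorem measurableSet_apply (x : Fin d → ℤ) : MeasurableSet {ω : Env d | ω x = true} :=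
  measurableSet_eq_fun (measurable_pi_apply x) measurable_const

theorem measurable_dist (e : Fin d → ℤ) : Measurable (dist e : Env d → ℕ) := by
  refine measurable_to_countable' fun n => ?_
  rcases Nat.eq_zero_or_pos n with rfl | hn
  · have : dist e ⁻¹' {0} = ⋂ n : ℕ, ⋂ _ : 0 < n, {ω : Env d | ω (n • e) = true}ᶜ := by
      ext ω
      simp only [Set.mem_preimage, Set.mem_singleton_iff, Set.mem_iInter, Set.mem_compl_iff,
        Set.mem_ofPred_eq]
      rw [← not_iff_not, ← ne_eq, ← Nat.pos_iff_ne_zero, dist_pos_iff]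
      push Not
      rfl
    rw [this]
    exact .iInter fun n => .iInter fun _ => (measurableSet_apply _).compl
  · have : dist e ⁻¹' {n} = {ω : Env d | ω (n • e) = true} ∩
        ⋂ m : ℕ, ⋂ _ : 0 < m, ⋂ _ : m < n, {ω : Env d | ω (m • e) = true}ᶜ := by
      ext ω
      simp only [Set.mem_preimage, Set.mem_singleton_iff, Set.mem_iInter, Set.mem_compl_iff,
        Set.mem_ofPred_eq, Set.mem_inter_iff]
      exact dist_eq_iff hn
    rw [this]
    exact (measurableSet_apply _).inter
      (.iInter fun m => .iInter fun _ => .iInter fun _ => (measurableSet_apply _).compl)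

theorem measurable_inducedShift (e : Fin d → ℤ) :
    Measurable (inducedShift e : Env d → Env d) := by
  have h : Measurable fun p : ℕ × Env d => shift (p.1 • e) p.2 :=
    measurable_from_prod_countable_right fun n => measurable_shift (n • e)
  exact h.comp ((measurable_dist e).prodMk measurable_id)

theorem measurableSet_envZero : MeasurableSet (envZero d) := measurableSet_apply 0

/-- Poincaré recurrence: almost surely, if the origin is a point, then there is another point in
direction `e`. -/
theorem ae_dist_pos {Q : Measure (Env d)} [IsFiniteMeasure Q] {e : Fin d → ℤ}
    (he : MeasurePreserving (shift e) Q Q) : ∀ᵐ ω ∂Q, ω ∈ envZero d → 0 < dist e ω := by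
  filter_upwards [he.conservative.ae_mem_imp_frequently_image_mem
    (measurableSet_envZero (d := d)).nullMeasurableSet] with ω hω h0
  obtain ⟨n, hn, h⟩ := (frequently_atTop.mp (hω h0)) 1
  refine dist_pos_iff.mpr ⟨n, hn, ?_⟩
  rw [shift_iterate] at h
  simpa [envZero, shift] using h

theorem measure_eq_tsum_inter_fiber {α : Type*} [MeasurableSpace α] (μ : Measure α) {f : α → ℕ}
    (hf : Measurable f) {s : Set α} (hs : MeasurableSet s) :
    μ s = ∑' n, μ (s ∩ f ⁻¹' {n}) := by
  rw [← measure_iUnion _ fun n => hs.inter (hf (MeasurableSet.singleton n))]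
  · rw [← Set.inter_iUnion, ← Set.preimage_iUnion, Set.iUnion_of_singleton, Set.preimage_univ,
      Set.inter_univ]
  · intro m n hmn
    refine Disjoint.mono Set.inter_subset_right Set.inter_subset_right ?_
    exact Disjoint.preimage f (Set.disjoint_singleton.mpr hmn)

/-- The induced shift preserves `P`. The event that the next point in direction
`e` is at distance `n` is the shift by `n e` of the event that the previous point is at
distance `n`. -/
theorem measurePreserving_inducedShift {Q : Measure (Env d)} [IsFiniteMeasure Q] {e : Fin d → ℤ}
    (he : MeasurePreserving (shift e) Q Q) (he' : MeasurePreserving (shift (-e)) Q Q) :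
    MeasurePreserving (inducedShift e) (condLaw Q) (condLaw Q) := by
  suffices h : MeasurePreserving (inducedShift e) (Q.restrict (envZero d))
      (Q.restrict (envZero d)) from h.smul_measure _
  refine ⟨measurable_inducedShift e, Measure.ext fun B hB => ?_⟩
  have hB' := measurable_inducedShift e hB
  rw [Measure.map_apply (measurable_inducedShift e) hB, Measure.restrict_apply hB',
    Measure.restrict_apply hB,
    measure_eq_tsum_inter_fiber Q (measurable_dist e) (hB'.inter measurableSet_envZero),
    measure_eq_tsum_inter_fiber Q (measurable_dist (-e)) (hB.inter measurableSet_envZero)]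
  congr 1
  funext n
  rcases Nat.eq_zero_or_pos n with rfl | hn
  · have null : ∀ (e : Fin d → ℤ) (s : Set (Env d)), MeasurePreserving (shift e) Q Q →
        Q (s ∩ envZero d ∩ dist e ⁻¹' {0}) = 0 := fun e s he => by
      refine measure_mono_null ?_ (ae_dist_pos he)
      rintro ω ⟨⟨-, h0⟩, h1⟩ h
      exact (h h0).ne' h1
    rw [null e _ he, null (-e) _ he']
  · have hmeas : MeasurableSet (B ∩ envZero d ∩ dist (-e) ⁻¹' {n}) :=
      (hB.inter measurableSet_envZero).inter (measurable_dist (-e) (MeasurableSet.singleton n))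
    rw [← (measurePreserving_shift_nsmul he n).measure_preimage hmeas.nullMeasurableSet]
    congr 1
    ext ω
    constructor
    · rintro ⟨⟨h1, h0⟩, rfl⟩
      exact ⟨⟨h1, inducedShift_mem_envZero hn⟩, dist_neg_inducedShift h0 hn⟩
    · rintro ⟨⟨h1, h0⟩, h2⟩
      have h2 : dist (-e) (shift (n • e) ω) = n := h2
      have hpos : 0 < dist (-e) (shift (n • e) ω) := h2.symm ▸ hn
      have hω : inducedShift (-e) (shift (n • e) ω) = ω := by
        rw [inducedShift, h2, shift_shift, smul_neg, add_neg_cancel, shift_zero]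
      have h3 := dist_neg_inducedShift h0 hpos
      rw [neg_neg, hω, h2] at h3
      refine ⟨⟨?_, hω ▸ inducedShift_mem_envZero hpos⟩, h3⟩
      rwa [Set.mem_preimage, inducedShift, h3]

theorem ae_condLaw_mem_envZero (Q : Measure (Env d)) : ∀ᵐ ω ∂(condLaw Q), ω ∈ envZero d :=
  Measure.ae_smul_measure (ae_restrict_mem measurableSet_envZero) _

theorem condLaw_absolutelyContinuous (Q : Measure (Env d)) : condLaw Q ≪ Q :=
  ProbabilityTheory.cond_absolutelyContinuous

instance (Q : Measure (Env d)) : IsFiniteMeasure (condLaw Q) := by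
  unfold condLaw
  infer_instance

end PointProcessWalk

/-! ### The resolvent equation in `L²(P)` -/

theorem coeFn_sum_Lp {α E ι : Type*} [MeasurableSpace α] {μ : Measure α} [NormedAddCommGroup E]
    {p : ℝ≥0∞} (s : Finset ι) (f : ι → Lp E p μ) :
    ⇑(∑ i ∈ s, f i) =ᵐ[μ] fun x => ∑ i ∈ s, f i x := by
  classical
  induction s using Finset.induction_on with
  | empty => exact Lp.coeFn_zero E p μ
  | insert i s hi ih =>
    rw [Finset.sum_insert hi]
    filter_upwards [Lp.coeFn_add (f i) (∑ i ∈ s, f i), ih] with x h1 h2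
    rw [h1, Pi.add_apply, h2, Finset.sum_insert hi]

namespace PointProcessWalk

variable {d : ℕ} {Q : Measure (Env d)}

theorem IsErgodicPointProcess.measurePreserving_inducedShift [IsFiniteMeasure Q]
    (hQ : IsErgodicPointProcess Q) {e : Fin d → ℤ} (he : e ∈ directions d) :
    MeasurePreserving (inducedShift e) (condLaw Q) (condLaw Q) :=
  PointProcessWalk.measurePreserving_inducedShift (hQ.measurePreserving_shift he)
    (hQ.measurePreserving_shift (neg_mem_directions he))

theorem IsErgodicPointProcess.ae_dist_pos [IsFiniteMeasure Q]
    (hQ : IsErgodicPointProcess Q) {e : Fin d → ℤ} (he : e ∈ directions d) :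
    ∀ᵐ ω ∂(condLaw Q), 0 < dist e ω := by
  filter_upwards [ae_condLaw_mem_envZero Q, (condLaw_absolutelyContinuous Q).ae_le
    (PointProcessWalk.ae_dist_pos (hQ.measurePreserving_shift he))] with ω h0 h
  exact h h0

/-- Distinct coordinate directions span distinct rays. -/
theorem eq_of_nsmul_eq_nsmul {e e' : Fin d → ℤ} (he : e ∈ directions d) (he' : e' ∈ directions d)
    {m m' : ℕ} (hm : 0 < m) (h : m • e = m' • e') : e = e' := by
  obtain ⟨i, hi⟩ := mem_directions.mp he
  obtain ⟨j, hj⟩ := mem_directions.mp he'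
  have hij : i = j := by
    by_contra hne
    have := congrFun h i
    rcases hi with rfl | rfl <;> rcases hj with rfl | rfl <;>
      simp [hne] at this <;> omega
  subst hij
  have := congrFun h i
  rcases hi with rfl | rfl <;> rcases hj with rfl | rfl <;> simp at this ⊢ <;> omega

theorem sum_neighbors {M : Type*} [AddCommMonoid M] {ω : Env d}
    (h : ∀ e ∈ directions d, 0 < dist e ω) (g : (Fin d → ℤ) → M) :
    ∑ x ∈ neighbors 0 ω, g x = ∑ e : directions d, g (dist e.1 ω • e.1) := by
  rw [neighbors, Finset.sum_image]
  · simp only [shift_zero, zero_add]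
    exact (Finset.sum_coe_sort (directions d) fun e => g (dist e ω • e)).symm
  · intro e he e' he' heq
    simp only [shift_zero, zero_add] at heq
    exact eq_of_nsmul_eq_nsmul he he' (h e he) heq

/-- The reflection `e ↦ -e` of the coordinate directions. -/
def negDirection : Equiv.Perm (directions d) where
  toFun e := ⟨-e.1, neg_mem_directions e.2⟩
  invFun e := ⟨-e.1, neg_mem_directions e.2⟩
  left_inv _ := Subtype.ext (neg_neg _)
  right_inv _ := Subtype.ext (neg_neg _)

/-- The Koopman operator `ψ ↦ ψ ∘ σ_e` on `L²(P; ℝ^d)`. -/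
noncomputable def koopman [IsFiniteMeasure Q] (hQ : IsErgodicPointProcess Q) (e : directions d) :
    Lp (EuclideanSpace ℝ (Fin d)) 2 (condLaw Q) →ₗᵢ[ℝ]
      Lp (EuclideanSpace ℝ (Fin d)) 2 (condLaw Q) :=
  Lp.compMeasurePreservingₗᵢ ℝ (inducedShift e.1) (hQ.measurePreserving_inducedShift e.2)

theorem coeFn_koopman [IsFiniteMeasure Q] (hQ : IsErgodicPointProcess Q) (e : directions d)
    (φ : Lp (EuclideanSpace ℝ (Fin d)) 2 (condLaw Q)) :
    koopman hQ e φ =ᵐ[condLaw Q] fun ω => φ (inducedShift e.1 ω) :=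
  Lp.coeFn_compMeasurePreserving φ (hQ.measurePreserving_inducedShift e.2)

theorem koopman_negDirection [IsFiniteMeasure Q] (hQ : IsErgodicPointProcess Q)
    (e : directions d) (φ : Lp (EuclideanSpace ℝ (Fin d)) 2 (condLaw Q)) :
    koopman hQ e (koopman hQ (negDirection e) φ) = φ := by
  refine Lp.ext ?_
  filter_upwards [coeFn_koopman hQ e (koopman hQ (negDirection e) φ),
    (hQ.measurePreserving_inducedShift e.2).quasiMeasurePreserving.ae
      (coeFn_koopman hQ (negDirection e) φ),
    ae_condLaw_mem_envZero Q, hQ.ae_dist_pos e.2] with ω h1 h2 h0 hpos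
  rw [h1, h2]
  exact congrArg φ (inducedShift_neg_inducedShift h0 hpos)

/-- The jump `f_e(ω) e` from the origin in direction `e`. -/
noncomputable def jump (e : Fin d → ℤ) (ω : Env d) : EuclideanSpace ℝ (Fin d) :=
  toSpace (dist e ω • e)

theorem jump_eq_smul (e : Fin d → ℤ) (ω : Env d) : jump e ω = (dist e ω : ℝ) • toSpace e := by
  ext i
  simp [jump, toSpace]

theorem memLp_jump {e : Fin d → ℤ}
    (h : ∫⁻ ω, (dist e ω : ℝ≥0∞) ^ 2 ∂(condLaw Q) < ∞) : MemLp (jump e) 2 (condLaw Q) := by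
  have hmeas : Measurable fun ω : Env d => (dist e ω : ℝ) :=
    measurable_from_top.comp (measurable_dist e)
  have hm : MemLp (fun ω : Env d => (dist e ω : ℝ)) 2 (condLaw Q) := by
    refine ⟨hmeas.aestronglyMeasurable, ?_⟩
    rw [eLpNorm_lt_top_iff_lintegral_rpow_enorm_lt_top two_ne_zero ENNReal.ofNat_ne_top]
    simpa using h
  refine hm.of_le_mul (c := ‖toSpace e‖) ?_ (ae_of_all _ fun ω => ?_)
  · simp only [funext (jump_eq_smul e)]
    exact (hmeas.smul_const _).aestronglyMeasurable
  · rw [jump_eq_smul, norm_smul, mul_comm]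

/-- The jump in direction `e`, as an element of `L²(P; ℝ^d)`. -/
noncomputable def jumpLp
    (hmom : ∀ e ∈ directions d, ∫⁻ ω, (dist e ω : ℝ≥0∞) ^ 2 ∂(condLaw Q) < ∞)
    (e : directions d) : Lp (EuclideanSpace ℝ (Fin d)) 2 (condLaw Q) :=
  (memLp_jump (hmom e.1 e.2)).toLp _

theorem koopman_jumpLp [IsFiniteMeasure Q]
    (hmom : ∀ e ∈ directions d, ∫⁻ ω, (dist e ω : ℝ≥0∞) ^ 2 ∂(condLaw Q) < ∞)
    (hQ : IsErgodicPointProcess Q) (e : directions d) :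
    koopman hQ (negDirection e) (jumpLp hmom e) = -jumpLp hmom (negDirection e) := by
  refine Lp.ext ?_
  filter_upwards [coeFn_koopman hQ (negDirection e) (jumpLp hmom e),
    (hQ.measurePreserving_inducedShift (negDirection e).2).quasiMeasurePreserving.ae
      (memLp_jump (hmom e.1 e.2)).coeFn_toLp,
    Lp.coeFn_neg (jumpLp hmom (negDirection e)),
    (memLp_jump (hmom _ (negDirection e).2)).coeFn_toLp,
    ae_condLaw_mem_envZero Q, hQ.ae_dist_pos (negDirection e).2] with ω h1 h2 h3 h4 h0 hpos
  rw [h1, h3, Pi.neg_apply]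
  refine h2.trans (Eq.trans ?_ (congrArg Neg.neg h4.symm))
  have h5 := dist_neg_inducedShift h0 hpos
  change dist (- -e.1) _ = _ at h5
  rw [neg_neg] at h5
  rw [jump_eq_smul, h5, jump_eq_smul, ← smul_neg]
  congr 1
  ext i
  simp [toSpace, negDirection]

/-- In `L²(P)`, the resolvent equation is the one for the average of the Koopman operators. -/
theorem isResolventSolution_iff [IsFiniteMeasure Q]
    (hmom : ∀ e ∈ directions d, ∫⁻ ω, (dist e ω : ℝ≥0∞) ^ 2 ∂(condLaw Q) < ∞)
    (hQ : IsErgodicPointProcess Q) {ε : ℝ}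
    {ψ : Env d → EuclideanSpace ℝ (Fin d)} (hψ : MemLp ψ 2 (condLaw Q)) :
    IsResolventSolution Q ε ψ ↔
      IsAverageResolvent (koopman hQ) (jumpLp hmom) (2 * (d : ℝ))⁻¹ ε (hψ.toLp ψ) := by
  have hpos : ∀ᵐ ω ∂(condLaw Q), ∀ e ∈ directions d, 0 < dist e ω :=
    (directions d).eventually_all.mpr fun e he => hQ.ae_dist_pos he
  have hright : ((2 * (d : ℝ))⁻¹ • ∑ e, jumpLp hmom e : Lp _ 2 (condLaw Q))
      =ᵐ[condLaw Q] drift := by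
    filter_upwards [Lp.coeFn_smul (2 * (d : ℝ))⁻¹ (∑ e, jumpLp hmom e),
      coeFn_sum_Lp Finset.univ (jumpLp hmom),
      ae_all_iff.mpr fun e : directions d => (memLp_jump (hmom e.1 e.2)).coeFn_toLp, hpos]
      with ω h1 h2 h3 h4
    rw [h1, Pi.smul_apply, h2, drift, sum_neighbors h4]
    congr 1
    exact Finset.sum_congr rfl fun e _ => h3 e
  have hleft : ((1 + ε) • hψ.toLp ψ - (2 * (d : ℝ))⁻¹ • ∑ e, koopman hQ e (hψ.toLp ψ) :
      Lp _ 2 (condLaw Q)) =ᵐ[condLaw Q] fun ω => (1 + ε) • ψ ω - transition ψ ω := by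
    filter_upwards [Lp.coeFn_sub ((1 + ε) • hψ.toLp ψ)
        ((2 * (d : ℝ))⁻¹ • ∑ e, koopman hQ e (hψ.toLp ψ)),
      Lp.coeFn_smul (1 + ε) (hψ.toLp ψ), hψ.coeFn_toLp,
      Lp.coeFn_smul (2 * (d : ℝ))⁻¹ (∑ e, koopman hQ e (hψ.toLp ψ)),
      coeFn_sum_Lp Finset.univ (fun e => koopman hQ e (hψ.toLp ψ)),
      ae_all_iff.mpr fun e : directions d => coeFn_koopman hQ e (hψ.toLp ψ),
      ae_all_iff.mpr fun e : directions d =>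
        (hQ.measurePreserving_inducedShift e.2).quasiMeasurePreserving.ae hψ.coeFn_toLp, hpos]
      with ω h1 h2 h3 h4 h5 h6 h7 h8
    rw [h1, Pi.sub_apply, h2, Pi.smul_apply, h3, h4, Pi.smul_apply, h5, transition,
      sum_neighbors h8]
    congr 2
    exact Finset.sum_congr rfl fun e _ => (h6 e).trans (h7 e)
  rw [IsAverageResolvent, Lp.ext_iff]
  constructor
  · rintro ⟨-, h⟩
    filter_upwards [h, hleft, hright] with ω h1 h2 h3
    rw [h2, h1, h3]
  · intro h
    refine ⟨hψ, ?_⟩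
    filter_upwards [h, hleft, hright] with ω h1 h2 h3
    rw [← h2, h1, h3]

theorem inv_two_mul_card_directions (hd : 0 < d) :
    (2 * (d : ℝ))⁻¹ * Fintype.card (directions d) = 1 := by
  rw [Fintype.card_coe, card_directions]
  have : (0 : ℝ) < d := Nat.cast_pos.mpr hd
  push_cast
  field_simp

theorem psi_spec {ε : ℝ} (h : ∃ ψ, IsResolventSolution Q ε ψ) :
    IsResolventSolution Q ε (psi Q ε) :=
  Classical.epsilon_spec h

/-- The resolvent equation is uniquely solvable in `L²`. -/
theorem isResolventSolution_psi [IsFiniteMeasure Q]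
    (hmom : ∀ e ∈ directions d, ∫⁻ ω, (dist e ω : ℝ≥0∞) ^ 2 ∂(condLaw Q) < ∞)
    (hd : 0 < d) (hQ : IsErgodicPointProcess Q)
    {ε : ℝ} (hε : 0 < ε) : IsResolventSolution Q ε (psi Q ε) ∧
      ∀ φ, IsResolventSolution Q ε φ → φ =ᵐ[condLaw Q] psi Q ε := by
  obtain ⟨Ψ, hΨ, huniq⟩ := existsUnique_isAverageResolvent negDirection (koopman_negDirection hQ)
    (koopman_jumpLp hmom hQ) (inv_two_mul_card_directions hd) hε
  have hsol : IsResolventSolution Q ε Ψ := by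
    rw [isResolventSolution_iff hmom hQ (Lp.memLp Ψ), Lp.toLp_coeFn]
    exact hΨ
  have key : ∀ φ, IsResolventSolution Q ε φ → φ =ᵐ[condLaw Q] Ψ := fun φ hφ => by
    have := huniq _ ((isResolventSolution_iff hmom hQ hφ.1).mp hφ)
    exact hφ.1.coeFn_toLp.symm.trans (by rw [this])
  have hpsi := psi_spec ⟨_, hsol⟩
  exact ⟨hpsi, fun φ hφ => (key φ hφ).trans (key _ hpsi).symm⟩

/-- The increments of `ψ_ε` along one step of the induced shift converge in `L²`. -/
theorem exists_tendsto_psi_step [IsFiniteMeasure Q]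
    (hmom : ∀ e ∈ directions d, ∫⁻ ω, (dist e ω : ℝ≥0∞) ^ 2 ∂(condLaw Q) < ∞)
    (hd : 0 < d) (hQ : IsErgodicPointProcess Q)
    {e : Fin d → ℤ} (he : e ∈ directions d) :
    ∃ G : Env d → EuclideanSpace ℝ (Fin d), MemLp G 2 (condLaw Q) ∧
      Tendsto (fun ε : ℝ => eLpNorm
        (fun ω => psi Q ε (inducedShift e ω) - psi Q ε ω - G ω) 2 (condLaw Q)) (𝓝[>] 0) (𝓝 0) := by
  obtain ⟨G, hG⟩ := exists_tendsto_isAverageResolvent negDirection (koopman_negDirection hQ)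
    (koopman_jumpLp hmom hQ) (inv_two_mul_card_directions hd)
  refine ⟨G ⟨e, he⟩, Lp.memLp _, ?_⟩
  have hpsi : ∀ ε : ℝ, 0 < ε → IsResolventSolution Q ε (psi Q ε) := fun ε hε =>
    (isResolventSolution_psi hmom hd hQ hε).1
  let Ψ : ℝ → Lp (EuclideanSpace ℝ (Fin d)) 2 (condLaw Q) := fun ε =>
    if hε : 0 < ε then (hpsi ε hε).1.toLp _ else 0
  have hΨ : ∀ ε (hε : 0 < ε), Ψ ε = (hpsi ε hε).1.toLp _ := fun ε hε => dif_pos hε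
  have h := hG Ψ (fun ε hε => by
    rw [hΨ ε hε]
    exact (isResolventSolution_iff hmom hQ (hpsi ε hε).1).mp (hpsi ε hε)) ⟨e, he⟩
  rw [Lp.tendsto_Lp_iff_tendsto_eLpNorm'] at h
  refine h.congr' ?_
  filter_upwards [self_mem_nhdsWithin] with ε hε
  refine eLpNorm_congr_ae ?_
  filter_upwards [Lp.coeFn_sub (koopman hQ ⟨e, he⟩ (Ψ ε)) (Ψ ε),
    coeFn_koopman hQ ⟨e, he⟩ (Ψ ε), (hpsi ε hε).1.coeFn_toLp,
    (hQ.measurePreserving_inducedShift he).quasiMeasurePreserving.ae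
      (hpsi ε hε).1.coeFn_toLp] with ω h1 h2 h3 h4
  rw [← hΨ ε hε] at h3 h4
  rw [Pi.sub_apply, h1, Pi.sub_apply, h2, h3]
  exact congrArg (fun z => z - psi Q ε ω - G ⟨e, he⟩ ω) h4

end PointProcessWalk

/-! ### Points on a coordinate axis and the corrector -/

namespace PointProcessWalk

variable {d : ℕ} {Q : Measure (Env d)} {e : Fin d → ℤ}

/-- The environments with a point at the origin whose orbit under `σ_e` never runs out of points
in direction `e`. -/
def forwardInfinite (e : Fin d → ℤ) : Set (Env d) :=
  {ω | ω ∈ envZero d ∧ ∀ k, 0 < dist e ((inducedShift e)^[k] ω)}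

theorem inducedShift_mem_forwardInfinite {ω : Env d} (h : ω ∈ forwardInfinite e) :
    inducedShift e ω ∈ forwardInfinite e :=
  ⟨inducedShift_mem_envZero (h.2 0), fun k => h.2 (k + 1)⟩

theorem IsErgodicPointProcess.ae_mem_forwardInfinite [IsFiniteMeasure Q]
    (hQ : IsErgodicPointProcess Q) (he : e ∈ directions d) :
    ∀ᵐ ω ∂(condLaw Q), ω ∈ forwardInfinite e := by
  filter_upwards [ae_condLaw_mem_envZero Q, ae_all_iff.mpr fun k : ℕ =>
    ((hQ.measurePreserving_inducedShift he).iterate k).quasiMeasurePreserving.ae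
      (hQ.ae_dist_pos he)] with ω h0 h
  exact ⟨h0, h⟩

theorem shift_pointPos (k : ℕ) (ω : Env d) :
    shift (pointPos e k ω • e) ω = (inducedShift e)^[k] ω := by
  induction k generalizing ω with
  | zero => simp [pointPos, shift_zero]
  | succ k ih =>
    rw [Function.iterate_succ_apply, ← ih, pointPos, add_nsmul, ← shift_shift]
    rfl

theorem pointPos_succ_eq (k : ℕ) (ω : Env d) :
    pointPos e (k + 1) ω = pointPos e k ω + dist e ((inducedShift e)^[k] ω) := by
  induction k generalizing ω with
  | zero => simp [pointPos]
  | succ k ih =>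
    rw [pointPos, ih, Function.iterate_succ_apply, ← add_assoc]
    rfl

theorem strictMono_pointPos {ω : Env d} (h : ω ∈ forwardInfinite e) :
    StrictMono fun k => pointPos e k ω :=
  strictMono_nat_of_lt_succ fun k => by
    rw [pointPos_succ_eq]
    exact Nat.lt_add_of_pos_right (h.2 k)

theorem apply_pointPos {ω : Env d} (h : ω ∈ forwardInfinite e) (k : ℕ) :
    ω (pointPos e k ω • e) = true := by
  have h1 : shift (pointPos e k ω • e) ω ∈ envZero d := by
    rw [shift_pointPos]
    cases k with
    | zero => exact h.1
    | succ k =>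
      rw [Function.iterate_succ_apply']
      exact inducedShift_mem_envZero (h.2 k)
  simpa [envZero, shift] using h1

/-- Every point on the axis in direction `e` is one of the enumerated points. -/
theorem exists_pointPos_eq {ω : Env d} (h : ω ∈ forwardInfinite e) {j : ℕ}
    (hj : ω (j • e) = true) : ∃ k, pointPos e k ω = j := by
  induction j using Nat.strong_induction_on generalizing ω with
  | _ j ih =>
    rcases Nat.eq_zero_or_pos j with rfl | hpos
    · exact ⟨0, rfl⟩
    have hle := dist_le hpos hj
    have hdist : 0 < dist e ω := h.2 0
    have hj' : inducedShift e ω ((j - dist e ω) • e) = true := by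
      rw [inducedShift, shift, ← add_nsmul, Nat.add_sub_cancel' hle]
      exact hj
    obtain ⟨k, hk⟩ := ih _ (by omega) (inducedShift_mem_forwardInfinite h) hj'
    exact ⟨k + 1, by rw [pointPos, hk, Nat.add_sub_cancel' hle]⟩

theorem measurable_pointPos (e : Fin d → ℤ) (k : ℕ) :
    Measurable (pointPos e k : Env d → ℕ) := by
  induction k with
  | zero => exact measurable_const
  | succ k ih => exact (measurable_dist e).add (ih.comp (measurable_inducedShift e))

variable {E : Type*} [NormedAddCommGroup E]

/-- The sum of `D` along the orbit of `σ_e` from the origin up to the site `j e`, if this site is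
a point, and zero otherwise. -/
noncomputable def orbitSum (e : Fin d → ℤ) (j : ℕ) (D : Env d → E) : Env d → E :=
  ∑ k ∈ Finset.range (j + 1), {ω | pointPos e k ω = j}.indicator (birkhoffSum (inducedShift e) D k)

theorem orbitSum_sub (j : ℕ) (D D' : Env d → E) :
    orbitSum e j (D - D') = orbitSum e j D - orbitSum e j D' := by
  have h : ∀ k, birkhoffSum (inducedShift e) (D - D') k =
      birkhoffSum (inducedShift e) D k - birkhoffSum (inducedShift e) D' k := fun k => by
    funext ω
    simp [birkhoffSum]
  rw [orbitSum, orbitSum, orbitSum, ← Finset.sum_sub_distrib]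
  refine Finset.sum_congr rfl fun k _ => ?_
  rw [h]
  exact Set.indicator_sub' _ _ _

theorem orbitSum_apply_of_pointPos_eq {ω : Env d} (h : ω ∈ forwardInfinite e) (D : Env d → E)
    {j k : ℕ} (hk : pointPos e k ω = j) :
    orbitSum e j D ω = birkhoffSum (inducedShift e) D k ω := by
  have hmono := strictMono_pointPos h
  rw [orbitSum, Finset.sum_apply, Finset.sum_eq_single k]
  · exact Set.indicator_of_mem (s := {ω | pointPos e k ω = j}) hk _
  · intro k' _ hne
    refine Set.indicator_of_notMem (s := {ω | pointPos e k' ω = j}) (fun hk' => hne ?_) _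
    exact hmono.injective (Eq.trans (show pointPos e k' ω = j from hk') hk.symm)
  · intro hnot
    have : k ≤ pointPos e k ω := hmono.le_apply
    exact absurd (Finset.mem_range.mpr (by omega)) hnot

/-- On the axis, the increments of `ψ` telescope along the orbit of `σ_e`. -/
theorem indicator_increment_eq_orbitSum {ω : Env d} (h : ω ∈ forwardInfinite e) (j : ℕ)
    (ψ : Env d → E) :
    {ω : Env d | ω (j • e) = true}.indicator (fun ω => ψ (shift (j • e) ω) - ψ ω) ω =
      orbitSum e j (fun ω => ψ (inducedShift e ω) - ψ ω) ω := by
  by_cases hj : ω (j • e) = true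
  · obtain ⟨k, rfl⟩ := exists_pointPos_eq h hj
    rw [Set.indicator_of_mem (s := {ω' : Env d | ω' (pointPos e k ω • e) = true}) hj,
      orbitSum_apply_of_pointPos_eq h _ rfl, birkhoffSum_coboundary, shift_pointPos]
  · rw [Set.indicator_of_notMem (s := {ω : Env d | ω (j • e) = true}) hj, orbitSum,
      Finset.sum_apply, Finset.sum_eq_zero]
    intro k _
    refine Set.indicator_of_notMem (s := {ω | pointPos e k ω = j}) (fun hk => hj ?_) _
    have hk : pointPos e k ω = j := hk
    rw [← hk]
    exact apply_pointPos h k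

theorem memLp_birkhoffSum {α : Type*} [MeasurableSpace α] {μ : Measure α} {σ : α → α}
    (hσ : MeasurePreserving σ μ μ) {p : ℝ≥0∞} {D : α → E} (hD : MemLp D p μ) (k : ℕ) :
    MemLp (birkhoffSum σ D k) p μ :=
  memLp_finsetSum _ fun i _ => hD.comp_measurePreserving (hσ.iterate i)

theorem eLpNorm_birkhoffSum_le {α : Type*} [MeasurableSpace α] {μ : Measure α} {σ : α → α}
    (hσ : MeasurePreserving σ μ μ) {p : ℝ≥0∞} (hp : 1 ≤ p) {D : α → E}
    (hD : AEStronglyMeasurable D μ) (k : ℕ) :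
    eLpNorm (birkhoffSum σ D k) p μ ≤ k * eLpNorm D p μ := by
  have h : birkhoffSum σ D k = ∑ i ∈ Finset.range k, D ∘ σ^[i] := by
    funext x
    simp [birkhoffSum]
  rw [h]
  refine (eLpNorm_sum_le (fun i _ => hD.comp_measurePreserving (hσ.iterate i)) hp).trans
    (le_of_eq ?_)
  simp [eLpNorm_comp_measurePreserving hD (hσ.iterate _)]

theorem measurableSet_pointPos_eq (e : Fin d → ℤ) (j k : ℕ) :
    MeasurableSet {ω : Env d | pointPos e k ω = j} :=
  measurable_pointPos e k (MeasurableSet.singleton j)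

theorem memLp_orbitSum {μ : Measure (Env d)} (hσ : MeasurePreserving (inducedShift e) μ μ)
    {p : ℝ≥0∞} {D : Env d → E} (hD : MemLp D p μ) (j : ℕ) : MemLp (orbitSum e j D) p μ :=
  memLp_finsetSum' _ fun k _ =>
    (memLp_birkhoffSum hσ hD k).indicator (measurableSet_pointPos_eq e j k)

theorem eLpNorm_orbitSum_le {μ : Measure (Env d)} (hσ : MeasurePreserving (inducedShift e) μ μ)
    {p : ℝ≥0∞} (hp : 1 ≤ p) {D : Env d → E} (hD : MemLp D p μ) (j : ℕ) :
    eLpNorm (orbitSum e j D) p μ ≤ (∑ k ∈ Finset.range (j + 1), (k : ℝ≥0∞)) * eLpNorm D p μ := by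
  refine (eLpNorm_sum_le (fun k _ => ((memLp_birkhoffSum hσ hD k).indicator
    (measurableSet_pointPos_eq e j k)).1) hp).trans ?_
  rw [Finset.sum_mul]
  exact Finset.sum_le_sum fun k _ =>
    (eLpNorm_indicator_le _).trans (eLpNorm_birkhoffSum_le hσ hp hD.1 k)

theorem corrector_spec {x : Fin d → ℤ} (h : ∃ g, IsCorrectorAt Q x g) :
    IsCorrectorAt Q x (corrector Q x) :=
  Classical.epsilon_spec h

/-- Limits in `L²` are unique up to null sets. -/
theorem IsCorrectorAt.ae_eq {x : Fin d → ℤ} {g g' : Env d → EuclideanSpace ℝ (Fin d)}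
    (hm : ∀ ε : ℝ, 0 < ε → AEStronglyMeasurable (psiIncrement Q ε x) (condLaw Q))
    (h : IsCorrectorAt Q x g) (h' : IsCorrectorAt Q x g') : g =ᵐ[condLaw Q] g' := by
  have hle : eLpNorm (g - g') 2 (condLaw Q) ≤ 0 := by
    have hlim := h.2.add h'.2
    rw [add_zero] at hlim
    refine ge_of_tendsto hlim ?_
    filter_upwards [self_mem_nhdsWithin] with ε hε
    have : g - g' = (psiIncrement Q ε x - g') - (psiIncrement Q ε x - g) := by abel
    rw [this, add_comm]
    exact eLpNorm_sub_le ((hm ε hε).sub h'.1.1) ((hm ε hε).sub h.1.1) one_le_two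
  have h0 := (eLpNorm_eq_zero_iff (h.1.1.sub h'.1.1) two_ne_zero).mp (le_antisymm hle zero_le)
  filter_upwards [h0] with ω hω
  exact sub_eq_zero.mp hω

theorem psiIncrement_ae_eq_orbitSum [IsFiniteMeasure Q] (hQ : IsErgodicPointProcess Q)
    (he : e ∈ directions d) (ε : ℝ) (j : ℕ) :
    psiIncrement Q ε (j • e) =ᵐ[condLaw Q]
      orbitSum e j (fun ω => psi Q ε (inducedShift e ω) - psi Q ε ω) := by
  filter_upwards [hQ.ae_mem_forwardInfinite he] with ω hω
  exact indicator_increment_eq_orbitSum hω j (psi Q ε)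

/-- If `ψ_ε ∘ σ_e - ψ_ε` tends to `G`, then the corrector at `j e` is the sum of `G` along the
orbit of `σ_e`. -/
theorem isCorrectorAt_orbitSum [IsFiniteMeasure Q] (hQ : IsErgodicPointProcess Q)
    (he : e ∈ directions d) (hψ : ∀ ε : ℝ, 0 < ε → MemLp (psi Q ε) 2 (condLaw Q))
    {G : Env d → EuclideanSpace ℝ (Fin d)} (hG : MemLp G 2 (condLaw Q))
    (hlim : Tendsto (fun ε : ℝ => eLpNorm
      (fun ω => psi Q ε (inducedShift e ω) - psi Q ε ω - G ω) 2 (condLaw Q)) (𝓝[>] 0) (𝓝 0))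
    (j : ℕ) : IsCorrectorAt Q (j • e) (orbitSum e j G) := by
  have hσ := hQ.measurePreserving_inducedShift he
  refine ⟨memLp_orbitSum hσ hG j, ?_⟩
  have hbound := ENNReal.Tendsto.const_mul (a := ∑ k ∈ Finset.range (j + 1), (k : ℝ≥0∞)) hlim
    (Or.inr (ENNReal.sum_ne_top.mpr fun k _ => ENNReal.natCast_ne_top k))
  rw [mul_zero] at hbound
  refine tendsto_of_tendsto_of_tendsto_of_le_of_le' tendsto_const_nhds hbound
    (Eventually.of_forall fun ε => zero_le) ?_
  filter_upwards [self_mem_nhdsWithin] with ε hε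
  have hD := ((hψ ε hε).comp_measurePreserving hσ).sub (hψ ε hε)
  have heq := (psiIncrement_ae_eq_orbitSum hQ he ε j).sub
    (ae_eq_refl (μ := condLaw Q) (orbitSum e j G))
  rw [eLpNorm_congr_ae heq, ← orbitSum_sub]
  exact eLpNorm_orbitSum_le hσ one_le_two (hD.sub hG) j

end PointProcessWalk

/-! ### Sublinearity along the axes -/

theorem theorem8p1 (d : ℕ) (Q : Measure (PointProcessWalk.Env d)) [IsProbabilityMeasure Q]
    (hQ : PointProcessWalk.IsErgodicPointProcess Q)
    (hmom : ∀ e ∈ PointProcessWalk.directions d,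
      ∫⁻ ω, (PointProcessWalk.dist e ω : ℝ≥0∞) ^ 2 ∂(PointProcessWalk.condLaw Q) < ∞) :
    (∀ ε : ℝ, 0 < ε → PointProcessWalk.IsResolventSolution Q ε (PointProcessWalk.psi Q ε) ∧
      ∀ φ, PointProcessWalk.IsResolventSolution Q ε φ →
        φ =ᵐ[PointProcessWalk.condLaw Q] PointProcessWalk.psi Q ε) ∧
    ∀ e ∈ PointProcessWalk.directions d,
      (∀ j : ℕ, PointProcessWalk.IsCorrectorAt Q (j • e)
        (PointProcessWalk.corrector Q (j • e))) ∧
      ∀ᵐ ω ∂(PointProcessWalk.condLaw Q),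
        Tendsto (fun k : ℕ => (k : ℝ)⁻¹ •
          PointProcessWalk.corrector Q (PointProcessWalk.pointPos e k ω • e) ω) atTop (𝓝 0) := by
  open PointProcessWalk in
  rcases Nat.eq_zero_or_pos d with rfl | hd
  · -- without directions, every function into `ℝ^0` solves the equation
    have hsub : ∀ f g : Env 0 → EuclideanSpace ℝ (Fin 0), f = g := fun f g =>
      Subsingleton.elim f g
    refine ⟨fun ε _ => ⟨⟨?_, ae_of_all _ fun ω => Subsingleton.elim _ _⟩,
      fun φ _ => by rw [hsub φ]⟩, fun e he => ?_⟩
    · rw [hsub (psi Q ε) 0]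
      exact MemLp.zero
    · obtain ⟨i, -⟩ := mem_directions.mp he
      exact i.elim0
  refine ⟨fun ε hε => isResolventSolution_psi hmom hd hQ hε, fun e he => ?_⟩
  have hψ : ∀ ε : ℝ, 0 < ε → MemLp (psi Q ε) 2 (condLaw Q) := fun ε hε =>
    (isResolventSolution_psi hmom hd hQ hε).1.1
  have hσ := hQ.measurePreserving_inducedShift he
  obtain ⟨G, hG, hlim⟩ := exists_tendsto_psi_step hmom hd hQ he
  have hcor := fun j => isCorrectorAt_orbitSum hQ he hψ hG hlim j
  have hspec := fun j => corrector_spec ⟨_, hcor j⟩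
  refine ⟨hspec, ?_⟩
  have heq : ∀ j : ℕ, corrector Q (j • e) =ᵐ[condLaw Q] orbitSum e j G := fun j =>
    IsCorrectorAt.ae_eq (fun ε hε => (memLp_orbitSum hσ
      (((hψ ε hε).comp_measurePreserving hσ).sub (hψ ε hε)) j).1.congr
        (psiIncrement_ae_eq_orbitSum hQ he ε j).symm) (hspec j) (hcor j)
  have hsub : Tendsto (fun n : ℕ => 1 / ((n : ℝ) + 1)) atTop (𝓝[>] 0) :=
    tendsto_nhdsWithin_iff.mpr ⟨tendsto_one_div_add_atTop_nhds_zero_nat,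
      Eventually.of_forall fun n => Set.mem_Ioi.mpr Nat.one_div_pos_of_nat⟩
  filter_upwards [hQ.ae_mem_forwardInfinite he, ae_all_iff.mpr heq,
    ae_tendsto_birkhoffSum_of_coboundary_limit hσ hG
      (fun n : ℕ => hψ (1 / ((n : ℝ) + 1)) Nat.one_div_pos_of_nat) (hlim.comp hsub)]
    with ω hω h1 h2
  refine h2.congr fun k => ?_
  rw [h1, orbitSum_apply_of_pointPos_eq hω G rfl]
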